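/- Let $n\ge 0$, let $W$ be the Weyl group of type $A_{2n+1}$ with index set $I=\{1,\dots,2n+1\}$ (the case $n=0$ being trivial), simple roots $\alpha_i$, simple reflections $s_i$, longest element $w_0$, and put $i^*=i^\vee=2n+2-i$. The commutation class $[\boldsymbol j]$ of a reduced word $\boldsymbol j$ of $w_0$ is the set of words obtained from it by exchanging adjacent letters $i,j$ with $|i-j|\ge 2$. Reflection functors are the operations $[i\,i_2\cdots i_N]\mapsto[i_2\cdots i_N\,i^*]$ and $[i_1\cdots i_{N-1}\,i]\mapsto[i^*\,i_1\cdots i_{N-1}]$ on classes. Let $[\![Q^\diamondsuit]\!]$ (the twisted adapted cluster point) be the set of all classes obtained by a sequence of reflection functors from the class of $\prod_{k=0}^{2n}(1\ 2\cdots n{+}1)^{k\vee}$, where $(j_1\cdots j_l)^{k\vee}$ is the word obtained by applying $\vee$ $k$ times to each letter. Let $\boldsymbol i_0=i_1i_2\cdots i_N$ be a word whose class lies in $[\![Q^\diamondsuit]\!]$. The twisted AR-quiver $\Upsilon_{[\boldsymbol i_0]}$ has vertices $1,\dots,N$; the vertex $k$ has residue $i_k$ and is labelled by the root $\beta_k=s_{i_1}\cdots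 s_{i_{k-1}}(\alpha_{i_k})$; there is an arrow $k\to j$ if $|i_k-i_j|=1$, $j=\max\{j'<k: i_{j'}=i_j\}$ and $k=\min\{k'>j: i_{k'}=i_k\}$. An $N$-sectional (resp. $S$-sectional) path is a path, possibly of length $0$, all of whose arrows decrease (resp. increase) the residue; it is maximal if no longer path of the same kind contains it; its length is its number of arrows; it is induced if it contains a vertex of residue different from $n+1$. For $1\le a\le b\le 2n+1$ the positive root $\sum_{a\le k\le b}\alpha_k$ is identified with the segment $[a,b]$, whose first component is $a$ and second component is $b$. Then $k\mapsto\beta_k$ is a bijection from the vertices of $\Upsilon_{[\boldsymbol i_0]}$ onto the segments $[a,b]$, $1\le a\le b\le 2n+1$, and: (1) all vertices of an induced maximal $N$-sectional path of length $k$ have first component $2n+1-k$; (2) all vertices of an induced maximal $S$-sectional path of length $k$ have second component $k+1$; (3) hence all vertices can be labelled without computing the $\beta_k$: the labelling $k\mapsto\beta_k$ is the only bijection from the vertices of $\Upsilon_{[\boldsymbol i_0]}$ onto the segments $[a,b]$, $1\le a\le b\le 2n+1$, that satisfies (1) and (2). -/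

import Mathlib

/-!
Type `A_m`. The index set `I = {1, …, m}` is modelled by `Fin m`: the element `i : Fin m`
stands for the index `i.val + 1`. Elements of the root lattice are coordinate vectors
`Fin m → ℤ` with respect to the basis of simple roots.
-/

namespace TwistedAR

/-- The simple root `α_i`. -/
def simpleRoot {m : ℕ} (i : Fin m) : Fin m → ℤ := Pi.single i 1

/-- The simple reflection `s_i` acting on the root lattice:
`s_i(β) = β - ⟨β, α_i^∨⟩ α_i`. -/
def simpleReflection {m : ℕ} (i : Fin m) (β : Fin m → ℤ) : Fin m → ℤ :=
  β - (∑ j, CartanMatrix.A m i j * β j) • simpleRoot i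

/-- The involution `*` of the index set of type `A_m` induced by the longest element
(`w₀ α_i = - α_{i*}`), that is `i* = m + 1 - i`. -/
def star {m : ℕ} (i : Fin m) : Fin m := Fin.rev i

/-- The nontrivial diagram automorphism `∨` of `A_{2n+1}`: `i^∨ = 2n + 2 - i`. -/
def vee {n : ℕ} (i : Fin (2 * n + 1)) : Fin (2 * n + 1) := Fin.rev i

/-! ### Commutation classes and reflection functors -/

/-- One commutation relation `i j = j i` (`i ≠ j` not joined in the Dynkin diagram) applied
inside a word. -/
inductive CommStep {m : ℕ} : List (Fin m) → List (Fin m) → Prop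
  | swap (u v : List (Fin m)) (i j : Fin m) (h : CartanMatrix.A m i j = 0) :
      CommStep (u ++ i :: j :: v) (u ++ j :: i :: v)

/-- Commutation classes of words: words modulo the equivalence relation generated by
commutation relations. -/
def CommClass (m : ℕ) : Type := Quot (CommStep (m := m))

/-- The commutation class `[i]` of a word. -/
def commClass {m : ℕ} (w : List (Fin m)) : CommClass m := Quot.mk _ w

/-- `ReflStep c c'`: the class `c'` is obtained from `c` by a (nontrivial) reflection functor.
Right action at a sink `i` of `c`: `[i i₂ ⋯ i_N] ↦ [i₂ ⋯ i_N i*]`.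
Left action at a source `i` of `c`: `[i₁ ⋯ i_{N-1} i] ↦ [i* i₁ ⋯ i_{N-1}]`. -/
inductive ReflStep {m : ℕ} : CommClass m → CommClass m → Prop
  | right (i : Fin m) (u : List (Fin m)) :
      ReflStep (commClass (i :: u)) (commClass (u ++ [star i]))
  | left (i : Fin m) (u : List (Fin m)) :
      ReflStep (commClass (u ++ [i])) (commClass (star i :: u))

/-- The `r`-cluster point of a class: all classes obtained from it by a sequence of reflection
functors. (Commutations and reflection functors preserve reduced words of `w₀`, so if `c` is a
class of such words then so are all elements of its `r`-cluster point.) -/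
def rClusterPoint {m : ℕ} (c : CommClass m) : Set (CommClass m) :=
  {c' | Relation.ReflTransGen ReflStep c c'}

/-- The word `1 2 ⋯ n+1` in the index set of type `A_{2n+1}`. -/
def baseBlock (n : ℕ) : List (Fin (2 * n + 1)) :=
  (List.finRange (n + 1)).map (Fin.castLE (by omega))

/-- The reduced word `∏_{k=0}^{2n} (1 2 ⋯ n+1)^{k∨}` of `w₀` of type `A_{2n+1}`. -/
def twistedWord (n : ℕ) : List (Fin (2 * n + 1)) :=
  (List.range (2 * n + 1)).flatMap fun k => (baseBlock n).map (vee^[k])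

/-- The twisted adapted cluster point of type `A_{2n+1}`. -/
def twistedAdaptedClusterPoint (n : ℕ) : Set (CommClass (2 * n + 1)) :=
  rClusterPoint (commClass (twistedWord n))

/-! ### The combinatorial Auslander–Reiten quiver -/

/-- The vertices of the combinatorial AR-quiver of a word are its positions. -/
abbrev Vertex {m : ℕ} (w : List (Fin m)) : Type := Fin w.length

/-- The residue of a vertex. -/
def residue {m : ℕ} (w : List (Fin m)) (k : Vertex w) : Fin m := w.get k

/-- The root `β_k = s_{i_1} ⋯ s_{i_{k-1}} (α_{i_k})` labelling the vertex `k`. -/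
def rootLabel {m : ℕ} (w : List (Fin m)) (k : Vertex w) : Fin m → ℤ :=
  (w.take k.val).foldr simpleReflection (simpleRoot (residue w k))

/-- There is an arrow from the vertex `k` to the vertex `j`: the residues are joined in the
Dynkin diagram, `j` is the last position before `k` having its residue, and `k` is the first
position after `j` having its residue. -/
def Arrow {m : ℕ} (w : List (Fin m)) (k j : Vertex w) : Prop :=
  CartanMatrix.A m (residue w k) (residue w j) = -1 ∧
  IsGreatest {j' : Vertex w | j' < k ∧ residue w j' = residue w j} j ∧
  IsLeast {k' : Vertex w | j < k' ∧ residue w k' = residue w k} k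

/-- Upward arrows. Residue `1` is drawn on top, so an arrow points upward if it lowers the
residue. -/
def UpArrow {m : ℕ} (w : List (Fin m)) (k j : Vertex w) : Prop :=
  Arrow w k j ∧ residue w j < residue w k

/-- Downward arrows: those which raise the residue. -/
def DownArrow {m : ℕ} (w : List (Fin m)) (k j : Vertex w) : Prop :=
  Arrow w k j ∧ residue w k < residue w j

/-- A path all of whose arrows are in the relation `R`, given by the nonempty list of its
consecutive vertices (a single vertex is a path of length `0`). -/
def IsPath {V : Type*} (R : V → V → Prop) (p : List V) : Prop :=
  p ≠ [] ∧ p.IsChain R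

/-- The length of a path: its number of arrows. -/
def pathLength {V : Type*} (p : List V) : ℕ := p.length - 1

/-- A path with arrows in `R` is maximal if no longer path with arrows in `R` contains it. -/
def IsMaximalPath {V : Type*} (R : V → V → Prop) (p : List V) : Prop :=
  IsPath R p ∧ ∀ q : List V, IsPath R q → p <:+: q → pathLength q ≤ pathLength p

/-- Maximal `N`-sectional paths. -/
def IsMaximalNSectional {m : ℕ} (w : List (Fin m)) (p : List (Vertex w)) : Prop :=
  IsMaximalPath (UpArrow w) p

/-- Maximal `S`-sectional paths. -/
def IsMaximalSSectional {m : ℕ} (w : List (Fin m)) (p : List (Vertex w)) : Prop :=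
  IsMaximalPath (DownArrow w) p

/-- A path in the quiver of a word of type `A_{2n+1}` is induced if it contains a vertex whose
residue is not `n + 1`. -/
def IsInduced {n : ℕ} (w : List (Fin (2 * n + 1))) (p : List (Vertex w)) : Prop :=
  ∃ v ∈ p, (residue w v).val + 1 ≠ n + 1

/-! ### Segments -/

/-- Segments `[a, b]` with `1 ≤ a ≤ b ≤ m`. -/
@[ext]
structure Segment (m : ℕ) where
  /-- the first component `a` -/
  first : ℕ
  /-- the second component `b` -/
  second : ℕ
  one_le_first : 1 ≤ first
  first_le_second : first ≤ second
  second_le : second ≤ m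

/-- The positive root `∑_{a ≤ k ≤ b} α_k` of type `A_m` identified with the segment `[a, b]`. -/
def Segment.root {m : ℕ} (s : Segment m) : Fin m → ℤ :=
  fun k => if s.first ≤ k.val + 1 ∧ k.val + 1 ≤ s.second then 1 else 0

/-- Every vertex of every induced maximal `N`-sectional path of length `k` has
`2n + 1 - k` as the first component of its label. -/
def NRule {n : ℕ} (w : List (Fin (2 * n + 1))) (f : Vertex w → Segment (2 * n + 1)) : Prop :=
  ∀ (p : List (Vertex w)) (k : ℕ), IsMaximalNSectional w p → IsInduced w p →
    pathLength p = k → ∀ v ∈ p, ((f v).first : ℤ) = 2 * n + 1 - k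

/-- Every vertex of every induced maximal `S`-sectional path of length `k` has `k + 1` as the
second component of its label. -/
def SRule {n : ℕ} (w : List (Fin (2 * n + 1))) (f : Vertex w → Segment (2 * n + 1)) : Prop :=
  ∀ (p : List (Vertex w)) (k : ℕ), IsMaximalSSectional w p → IsInduced w p →
    pathLength p = k → ∀ v ∈ p, (f v).second = k + 1

end TwistedAR

/-! ### Roots as pairs of wires. -/

namespace TwistedAR

/-! Read the word as a wiring diagram on the wires `0, …, 2n+1`: the letter `i : Fin (2n+1)` crosses
the wires at the positions `i` and `i+1`. The root at a crossing is `e_x - e_y`, where `x` and `y`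
enter from the left and from the right, so its segment is `[x+1, y]`. The word represents the
longest element and its length is the number of pairs of wires, so every pair crosses exactly once;
this gives the bijection.

The cluster point is used through one invariant, `IsTwisted`: a central wire takes part in exactly
the crossings of the middle residue, every other wire turns around only at the boundary, and the
diagram, with directions, ends in the mirror image of its initial state. This survives commutations
and reflection functors, and holds for the twisted word.

An `N`-sectional path follows one wire `x` moving to the right. If `x` is not central, a maximal
path stops only at the boundary or at the start or end of the diagram; it cannot run from start to
end without reaching the boundary, because the mirror condition reverses the direction of `x`. In
the remaining cases its length is `2n - x` (`Wiring.leftWire_add_pathLength`). Induced paths avoid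
the central wire, which gives the first rule; the second is the first one for the mirrored diagram.

For uniqueness, both rules apply off the middle residue. A middle crossing has one noncentral wire,
whose component is forced; that wire meets the middle residue only once, so injectivity settles the
other component. -/

/-- The transposition of the wires at the positions `i` and `i + 1`. -/
def adjSwap {m : ℕ} (i : Fin m) : Equiv.Perm (Fin (m + 1)) := Equiv.swap i.castSucc i.succ

/-- The vector `e_a - e_b` in the basis of simple roots. -/
def diffRoot {m : ℕ} (a b : Fin (m + 1)) : Fin m → ℤ :=
  fun k => (if a.val ≤ k.val then 1 else 0) - (if b.val ≤ k.val then 1 else 0)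

theorem adjSwap_castSucc {m : ℕ} (i : Fin m) : adjSwap i i.castSucc = i.succ :=
  Equiv.swap_apply_left _ _

theorem adjSwap_succ {m : ℕ} (i : Fin m) : adjSwap i i.succ = i.castSucc :=
  Equiv.swap_apply_right _ _

theorem adjSwap_of_ne {m : ℕ} {i : Fin m} {p : Fin (m + 1)} (h₁ : p ≠ i.castSucc)
    (h₂ : p ≠ i.succ) : adjSwap i p = p :=
  Equiv.swap_apply_of_ne_of_ne h₁ h₂

/-- A root `e_a - e_b` is a difference of two step vectors. The boundary term at the last node does
not depend on `a`, so it cancels in the difference. -/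
theorem cartan_sum_step {m : ℕ} (i : Fin m) (a : Fin (m + 1)) :
    ∑ j, CartanMatrix.A m i j * (if a.val ≤ j.val then 1 else 0) =
      (if a = i.castSucc then 1 else 0) - (if a = i.succ then 1 else 0) +
        if i.val + 1 = m then 1 else 0 := by
  let F : ℕ → ℤ := fun j =>
    (if i.val = j then (if a.val ≤ i.val then 2 else 0) else 0) -
      (if i.val + 1 = j then (if a.val ≤ i.val + 1 then 1 else 0) else 0) -
      -- The guard `0 < i.val` neutralises the truncated subtraction at the first node.
      (if i.val - 1 = j then (if 0 < i.val ∧ a.val ≤ i.val - 1 then 1 else 0) else 0)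
  have expand : ∀ j : Fin m,
      CartanMatrix.A m i j * (if a.val ≤ j.val then 1 else 0) = F j.val := by
    intro j
    simp only [CartanMatrix.A, Matrix.of_apply, Fin.ext_iff, F]
    split_ifs <;> omega
  rw [Finset.sum_congr rfl fun j _ => expand j, Fin.sum_univ_eq_sum_range F m]
  simp only [F, Finset.sum_sub_distrib, Finset.sum_ite_eq, Finset.mem_range, Fin.ext_iff,
    Fin.val_succ, Fin.val_castSucc]
  have := i.isLt
  have := a.isLt
  split_ifs <;> omega

theorem simpleReflection_diffRoot {m : ℕ} (i : Fin m) (a b : Fin (m + 1)) :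
    simpleReflection i (diffRoot a b) = diffRoot (adjSwap i a) (adjSwap i b) := by
  have key : ∑ j, CartanMatrix.A m i j * diffRoot a b j =
      ((if a = i.castSucc then 1 else 0) - (if a = i.succ then 1 else 0)) -
      ((if b = i.castSucc then 1 else 0) - (if b = i.succ then 1 else 0)) := by
    simp only [diffRoot, mul_sub, Finset.sum_sub_distrib, cartan_sum_step]
    ring
  have step : ∀ (a : Fin (m + 1)) (k : Fin m),
      ((if (adjSwap i a).val ≤ k.val then 1 else 0 : ℤ)) = (if a.val ≤ k.val then 1 else 0) -
        ((if a = i.castSucc then 1 else 0) - (if a = i.succ then 1 else 0)) *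
          (if k = i then 1 else 0) := by
    intro a k
    by_cases h₁ : a = i.castSucc
    · subst h₁
      have : i.castSucc ≠ i.succ := Fin.castSucc_lt_succ.ne
      rw [adjSwap_castSucc]
      simp only [Fin.val_succ, Fin.val_castSucc, this, if_true, if_false, Fin.ext_iff]
      split_ifs <;> omega
    · by_cases h₂ : a = i.succ
      · subst h₂
        rw [adjSwap_succ]
        simp only [Fin.val_succ, Fin.val_castSucc, h₁, if_true, if_false, Fin.ext_iff]
        split_ifs <;> omega
      · rw [adjSwap_of_ne h₁ h₂]
        simp [h₁, h₂]
  funext k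
  simp only [simpleReflection, key, Pi.sub_apply, Pi.smul_apply, smul_eq_mul, simpleRoot,
    Pi.single_apply]
  simp only [diffRoot, step]
  ring

theorem simpleRoot_eq_diffRoot {m : ℕ} (i : Fin m) :
    simpleRoot i = diffRoot i.castSucc i.succ := by
  funext k
  simp only [simpleRoot, diffRoot, Pi.single_apply, Fin.ext_iff, Fin.val_succ, Fin.val_castSucc]
  split_ifs <;> omega

theorem foldr_simpleReflection_diffRoot {m : ℕ} (u : List (Fin m)) (a b : Fin (m + 1)) :
    u.foldr simpleReflection (diffRoot a b) =
      diffRoot ((u.map adjSwap).prod a) ((u.map adjSwap).prod b) := by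
  induction u with
  | nil => rfl
  | cons i u ih => simp [ih, simpleReflection_diffRoot]

theorem rootLabel_eq_diffRoot {m : ℕ} (w : List (Fin m)) (v : Vertex w) :
    rootLabel w v = diffRoot (((w.take v.val).map adjSwap).prod (residue w v).castSucc)
      (((w.take v.val).map adjSwap).prod (residue w v).succ) := by
  rw [rootLabel, simpleRoot_eq_diffRoot, foldr_simpleReflection_diffRoot]

theorem adjSwap_rev {m : ℕ} (i : Fin m) :
    adjSwap i.rev = Fin.revPerm * adjSwap i * Fin.revPerm := by
  have h := Equiv.swap_apply_apply (Fin.revPerm (n := m + 1)) i.castSucc i.succ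
  simp only [Fin.revPerm_apply, Fin.rev_castSucc, Fin.rev_succ] at h
  rw [adjSwap, Equiv.swap_comm, h, adjSwap]
  rfl

/-! ### Directions of wires and admissible crossings. -/

/-- The state of a wiring diagram: every position carries the direction in which its wire arrived
there (`1` moving to the right, `-1` moving to the left); the central wire is marked by `0`. -/
abbrev WireState (n : ℕ) : Type := Fin (2 * n + 1 + 1) → SignType

/-- The mark left at a position by a wire arriving in the direction `d`. -/
def arrive (d k : SignType) : SignType := if k = 0 then 0 else d

/-- The state after the crossing `i`. -/
def crossState {n : ℕ} (s : WireState n) (i : Fin (2 * n + 1)) : WireState n :=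
  Function.update (Function.update s i.castSucc (arrive (-1) (s i.succ))) i.succ
    (arrive 1 (s i.castSucc))

/-- The crossing `i` is admissible: away from the central wire, wires reverse their direction only
at the boundary, and the central wire takes part exactly in the crossings in the middle. -/
def Admissible {n : ℕ} (s : WireState n) (i : Fin (2 * n + 1)) : Prop :=
  (i.val = 0 ∨ s i.castSucc ≠ -1) ∧ (i.val = 2 * n ∨ s i.succ ≠ 1) ∧
    (i.val = n ↔ (s i.castSucc = 0 ∨ s i.succ = 0))

/-- The mirror image of a state. -/
def flipState {n : ℕ} (s : WireState n) : WireState n := fun p => -s p.rev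

/-- All the crossings of a word are admissible when performed in order. -/
def AdmissibleWord {n : ℕ} : WireState n → List (Fin (2 * n + 1)) → Prop
  | _, [] => True
  | s, i :: u => Admissible s i ∧ AdmissibleWord (crossState s i) u

theorem admissibleWord_append {n : ℕ} (s : WireState n) (u v : List (Fin (2 * n + 1))) :
    AdmissibleWord s (u ++ v) ↔ AdmissibleWord s u ∧ AdmissibleWord (u.foldl crossState s) v := by
  induction u generalizing s with
  | nil => simp [AdmissibleWord]
  | cons i u ih => simp [AdmissibleWord, ih, and_assoc]

theorem crossState_castSucc {n : ℕ} (s : WireState n) (i : Fin (2 * n + 1)) :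
    crossState s i i.castSucc = arrive (-1) (s i.succ) := by
  rw [crossState, Function.update_of_ne Fin.castSucc_lt_succ.ne, Function.update_self]

theorem crossState_succ {n : ℕ} (s : WireState n) (i : Fin (2 * n + 1)) :
    crossState s i i.succ = arrive 1 (s i.castSucc) := by
  rw [crossState, Function.update_self]

theorem crossState_of_ne {n : ℕ} (s : WireState n) {i : Fin (2 * n + 1)}
    {p : Fin (2 * n + 1 + 1)} (h₁ : p ≠ i.castSucc) (h₂ : p ≠ i.succ) :
    crossState s i p = s p := by
  rw [crossState, Function.update_of_ne h₂, Function.update_of_ne h₁]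

theorem arrive_eq_zero {d k : SignType} (hd : d ≠ 0) : arrive d k = 0 ↔ k = 0 := by
  unfold arrive
  split_ifs <;> simp_all

theorem neg_arrive (d k : SignType) : -arrive d k = arrive (-d) (-k) := by
  revert d k
  unfold arrive
  decide

theorem flipState_flipState {n : ℕ} (s : WireState n) : flipState (flipState s) = s := by
  funext p
  simp [flipState]

theorem crossState_eq_zero {n : ℕ} (s : WireState n) (i : Fin (2 * n + 1))
    (p : Fin (2 * n + 1 + 1)) : crossState s i p = 0 ↔ s (adjSwap i p) = 0 := by
  by_cases h₁ : p = i.castSucc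
  · subst h₁
    rw [crossState_castSucc, adjSwap_castSucc, arrive_eq_zero (by decide)]
  · by_cases h₂ : p = i.succ
    · subst h₂
      rw [crossState_succ, adjSwap_succ, arrive_eq_zero (by decide)]
    · rw [crossState_of_ne s h₁ h₂, adjSwap_of_ne h₁ h₂]

theorem crossState_flipState {n : ℕ} (s : WireState n) (i : Fin (2 * n + 1)) :
    crossState (flipState s) i.rev = flipState (crossState s i) := by
  funext p
  by_cases h₁ : p = i.rev.castSucc
  · subst h₁
    rw [crossState_castSucc]
    simp only [flipState, Fin.rev_succ, Fin.rev_castSucc, Fin.rev_rev]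
    rw [crossState_succ, neg_arrive]
  · by_cases h₂ : p = i.rev.succ
    · subst h₂
      rw [crossState_succ]
      simp only [flipState, Fin.rev_succ, Fin.rev_castSucc, Fin.rev_rev]
      rw [crossState_castSucc, neg_arrive, neg_neg]
    · rw [crossState_of_ne _ h₁ h₂]
      simp only [flipState]
      rw [crossState_of_ne]
      · intro h
        exact h₂ (by rw [← Fin.rev_castSucc, ← h, Fin.rev_rev])
      · intro h
        exact h₁ (by rw [← Fin.rev_succ, ← h, Fin.rev_rev])

theorem admissible_flipState {n : ℕ} {s : WireState n} {i : Fin (2 * n + 1)}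
    (h : Admissible s i) : Admissible (flipState s) i.rev := by
  obtain ⟨h₁, h₂, h₃⟩ := h
  have hi := i.isLt
  simp only [Admissible, flipState, Fin.rev_succ, Fin.rev_castSucc, Fin.rev_rev, Fin.val_rev]
  refine ⟨?_, ?_, ?_⟩
  · refine h₂.imp (fun h => by omega) (fun h h' => h (by simpa using congrArg Neg.neg h'))
  · refine h₁.imp (fun h => by omega) (fun h h' => h (by simpa using congrArg Neg.neg h'))
  · have : (2 * n + 1 - (i.val + 1) = n) ↔ i.val = n := by omega
    rw [this, h₃, or_comm]
    simp [SignType.neg_eq_zero_iff]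

theorem cartan_eq_zero {m : ℕ} {i j : Fin m} (h : CartanMatrix.A m i j = 0) :
    i.val + 1 < j.val ∨ j.val + 1 < i.val := by
  simp only [CartanMatrix.A, Matrix.of_apply, Fin.ext_iff] at h
  split_ifs at h <;> omega

theorem cartan_eq_neg_one {m : ℕ} {i j : Fin m} :
    CartanMatrix.A m i j = -1 ↔ (i.val + 1 = j.val ∨ j.val + 1 = i.val) := by
  simp only [CartanMatrix.A, Matrix.of_apply, Fin.ext_iff]
  split_ifs <;> simp <;> omega

theorem cartan_eq_zero_symm {m : ℕ} {i j : Fin m} (h : CartanMatrix.A m i j = 0) :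
    CartanMatrix.A m j i = 0 := by
  have := cartan_eq_zero h
  simp only [CartanMatrix.A, Matrix.of_apply, Fin.ext_iff]
  split_ifs <;> omega

theorem adjSwap_commute {m : ℕ} {i j : Fin m} (h : CartanMatrix.A m i j = 0) :
    adjSwap i * adjSwap j = adjSwap j * adjSwap i := by
  have h' := cartan_eq_zero h
  refine (Equiv.Perm.Disjoint.commute ?_)
  intro p
  by_cases h₁ : p = i.castSucc
  · right; subst h₁
    apply adjSwap_of_ne <;> simp [Fin.ext_iff] <;> omega
  · by_cases h₂ : p = i.succ
    · right; subst h₂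
      apply adjSwap_of_ne <;> simp [Fin.ext_iff] <;> omega
    · left; exact adjSwap_of_ne h₁ h₂

theorem crossState_commute {n : ℕ} (s : WireState n) {i j : Fin (2 * n + 1)}
    (h : CartanMatrix.A _ i j = 0) :
    crossState (crossState s i) j = crossState (crossState s j) i := by
  have h' := cartan_eq_zero h
  have e₁ : i.castSucc ≠ j.castSucc := by simp [Fin.ext_iff]; omega
  have e₂ : i.castSucc ≠ j.succ := by simp [Fin.ext_iff]; omega
  have e₃ : i.succ ≠ j.castSucc := by simp [Fin.ext_iff]; omega
  have e₄ : i.succ ≠ j.succ := by simp [Fin.ext_iff]; omega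
  funext p
  by_cases h₁ : p = i.castSucc
  · subst h₁
    rw [crossState_of_ne _ e₁ e₂, crossState_castSucc, crossState_castSucc,
      crossState_of_ne _ e₃ e₄]
  by_cases h₂ : p = i.succ
  · subst h₂
    rw [crossState_of_ne _ e₃ e₄, crossState_succ, crossState_succ, crossState_of_ne _ e₁ e₂]
  rw [crossState_of_ne (crossState s j) h₁ h₂]
  by_cases h₃ : p = j.castSucc
  · subst h₃
    rw [crossState_castSucc, crossState_castSucc, crossState_of_ne _ e₂.symm e₄.symm]
  by_cases h₄ : p = j.succ
  · subst h₄
    rw [crossState_succ, crossState_succ, crossState_of_ne _ e₁.symm e₃.symm]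
  rw [crossState_of_ne _ h₃ h₄, crossState_of_ne _ h₁ h₂, crossState_of_ne _ h₃ h₄]

theorem admissible_crossState {n : ℕ} {s : WireState n} {i j : Fin (2 * n + 1)}
    (h : CartanMatrix.A _ i j = 0) : Admissible (crossState s i) j ↔ Admissible s j := by
  have h' := cartan_eq_zero h
  simp only [Admissible]
  rw [crossState_of_ne, crossState_of_ne] <;> simp [Fin.ext_iff] <;> omega

/-! ### Invariance under commutations and reflection functors. -/

/-- The word of length `(n + 1)(2n + 1)` of an admissible wiring diagram of the longest element,
ending in the mirror image of the state in which it starts. -/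
def IsTwisted {n : ℕ} (w : List (Fin (2 * n + 1))) : Prop :=
  w.length = (n + 1) * (2 * n + 1) ∧ (w.map adjSwap).prod = Fin.revPerm ∧
    ∃ s : WireState n, AdmissibleWord s w ∧ w.foldl crossState s = flipState s ∧
      ∃ c : Fin (2 * n + 1 + 1), (c.val = n ∨ c.val = n + 1) ∧ ∀ p, s p = 0 ↔ p = c

theorem IsTwisted.commStep {n : ℕ} {w w' : List (Fin (2 * n + 1))} (h : CommStep w w')
    (hw : IsTwisted w) : IsTwisted w' := by
  obtain ⟨u, v, i, j, hij⟩ := h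
  obtain ⟨hl, hp, s, ha, he, hc⟩ := hw
  refine ⟨?_, ?_, s, ?_, ?_, hc⟩
  · simpa using hl
  · rw [← hp]
    simp only [List.map_append, List.map_cons, List.prod_append, List.prod_cons]
    rw [← mul_assoc (adjSwap j), ← mul_assoc (adjSwap i), adjSwap_commute hij]
  · rw [admissibleWord_append] at ha ⊢
    refine ⟨ha.1, ?_⟩
    obtain ⟨h₁, h₂, h₃⟩ := ha.2
    rw [admissible_crossState hij] at h₂
    refine ⟨h₂, (admissible_crossState (cartan_eq_zero_symm hij)).2 h₁, ?_⟩
    rwa [← crossState_commute _ hij]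
  · rw [← he]
    simp only [List.foldl_append, List.foldl_cons]
    rw [crossState_commute _ hij]

theorem CommStep.symm {m : ℕ} {w w' : List (Fin m)} (h : CommStep w w') : CommStep w' w := by
  obtain ⟨u, v, i, j, hij⟩ := h
  exact .swap u v j i (cartan_eq_zero_symm hij)

/-- Admissibility lets the central wire move only through the middle crossing, which exchanges the
positions `n` and `n + 1`. -/
theorem middle_crossState {n : ℕ} {s : WireState n} {i : Fin (2 * n + 1)} (h : Admissible s i)
    (hc : ∃ c : Fin (2 * n + 1 + 1), (c.val = n ∨ c.val = n + 1) ∧ ∀ p, s p = 0 ↔ p = c) :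
    ∃ c : Fin (2 * n + 1 + 1), (c.val = n ∨ c.val = n + 1) ∧
      ∀ p, crossState s i p = 0 ↔ p = c := by
  obtain ⟨c, hc, h0⟩ := hc
  refine ⟨adjSwap i c, ?_, fun p => ?_⟩
  · by_cases h₁ : c = i.castSucc
    · have := h.2.2.2 (.inl ((h0 _).2 h₁.symm))
      rw [h₁, adjSwap_castSucc]
      simp [this]
    by_cases h₂ : c = i.succ
    · have := h.2.2.2 (.inr ((h0 _).2 h₂.symm))
      rw [h₂, adjSwap_succ]
      simp [this]
    rwa [adjSwap_of_ne h₁ h₂]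
  · rw [crossState_eq_zero, h0]
    constructor
    · rintro rfl
      exact (Equiv.swap_apply_self _ _ _).symm
    · rintro rfl
      exact Equiv.swap_apply_self _ _ _

theorem middle_flipState {n : ℕ} {s : WireState n}
    (hc : ∃ c : Fin (2 * n + 1 + 1), (c.val = n ∨ c.val = n + 1) ∧ ∀ p, s p = 0 ↔ p = c) :
    ∃ c : Fin (2 * n + 1 + 1), (c.val = n ∨ c.val = n + 1) ∧
      ∀ p, flipState s p = 0 ↔ p = c := by
  obtain ⟨c, hc, h0⟩ := hc
  refine ⟨c.rev, by rw [Fin.val_rev]; omega, fun p => ?_⟩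
  rw [flipState, SignType.neg_eq_zero_iff, h0, Fin.rev_eq_iff]

theorem middle_foldl {n : ℕ} {s : WireState n} {u : List (Fin (2 * n + 1))}
    (h : AdmissibleWord s u)
    (hc : ∃ c : Fin (2 * n + 1 + 1), (c.val = n ∨ c.val = n + 1) ∧ ∀ p, s p = 0 ↔ p = c) :
    ∃ c : Fin (2 * n + 1 + 1), (c.val = n ∨ c.val = n + 1) ∧
      ∀ p, u.foldl crossState s p = 0 ↔ p = c := by
  induction u generalizing s with
  | nil => exact hc
  | cons i u ih => exact ih h.2 (middle_crossState h.1 hc)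

theorem adjSwap_mul_self {m : ℕ} (i : Fin m) : adjSwap i * adjSwap i = 1 :=
  Equiv.swap_mul_self _ _

theorem revPerm_mul_self {m : ℕ} : (Fin.revPerm : Equiv.Perm (Fin m)) * Fin.revPerm = 1 := by
  ext p
  simp

/-- The new diagram starts after the crossing `i`. The old one ended in the mirror image of its
initial state, so the mirrored crossing `star i` is admissible there and leads to the mirror image
of the new initial state. -/
theorem IsTwisted.right {n : ℕ} {i : Fin (2 * n + 1)} {u : List (Fin (2 * n + 1))}
    (h : IsTwisted (i :: u)) : IsTwisted (u ++ [star i]) := by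
  obtain ⟨hl, hp, s, ⟨ha, hu⟩, he, hc⟩ := h
  rw [List.foldl_cons] at he
  refine ⟨by simpa using hl, ?_, crossState s i, ?_, ?_, middle_crossState ha hc⟩
  · simp only [List.map_cons, List.prod_cons] at hp
    simp only [List.map_append, List.prod_append, List.map_cons, List.map_nil, List.prod_cons,
      List.prod_nil, star, adjSwap_rev]
    rw [← one_mul (List.prod _), ← adjSwap_mul_self i, mul_assoc (adjSwap i), hp]
    simp only [mul_assoc]
    rw [← mul_assoc Fin.revPerm Fin.revPerm, revPerm_mul_self, one_mul, ← mul_assoc,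
      adjSwap_mul_self, one_mul, mul_one]
  · rw [admissibleWord_append, he]
    exact ⟨hu, admissible_flipState ha, trivial⟩
  · rw [List.foldl_append, he]
    exact crossState_flipState s i

/-- The new initial state is the mirror image of the state before the last crossing; performing
`star i` on it gives back the old initial state. -/
theorem IsTwisted.left {n : ℕ} {i : Fin (2 * n + 1)} {u : List (Fin (2 * n + 1))}
    (h : IsTwisted (u ++ [i])) : IsTwisted (star i :: u) := by
  obtain ⟨hl, hp, s, ha, he, hc⟩ := h
  rw [admissibleWord_append] at ha
  obtain ⟨hu, hi, -⟩ := ha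
  rw [List.foldl_append, List.foldl_cons, List.foldl_nil] at he
  have hs : crossState (flipState (u.foldl crossState s)) (star i) = s := by
    rw [star, crossState_flipState, he, flipState_flipState]
  refine ⟨by simpa using hl, ?_, flipState (u.foldl crossState s),
    ⟨admissible_flipState hi, by rwa [hs]⟩, ?_, middle_flipState (middle_foldl hu hc)⟩
  · simp only [List.map_append, List.prod_append, List.map_cons, List.map_nil, List.prod_cons,
      List.prod_nil, mul_one] at hp
    rw [List.map_cons, List.prod_cons, star, adjSwap_rev]
    have : (u.map adjSwap).prod = Fin.revPerm * adjSwap i := by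
      rw [← hp, mul_assoc, adjSwap_mul_self, mul_one]
    rw [this]
    simp only [mul_assoc]
    rw [← mul_assoc Fin.revPerm Fin.revPerm, revPerm_mul_self, one_mul,
      adjSwap_mul_self, mul_one]
  · rw [List.foldl_cons, hs, flipState_flipState]

theorem isTwisted_of_mem {n : ℕ} {w w₀ : List (Fin (2 * n + 1))} (h₀ : IsTwisted w₀)
    (hw : commClass w ∈ rClusterPoint (commClass w₀)) : IsTwisted w := by
  let Q : CommClass (2 * n + 1) → Prop := Quot.lift IsTwisted fun _ _ h =>
    propext ⟨IsTwisted.commStep h, IsTwisted.commStep h.symm⟩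
  suffices ∀ c, Relation.ReflTransGen ReflStep (commClass w₀) c → Q c from this _ hw
  intro c hc
  induction hc with
  | refl => exact h₀
  | tail _ hs ih =>
    cases hs with
    | right i u => exact IsTwisted.right ih
    | left i u => exact IsTwisted.left ih

/-! ### The twisted word satisfies the invariant. -/

theorem admissibleWord_map_vee {n : ℕ} {s : WireState n} {u : List (Fin (2 * n + 1))}
    (h : AdmissibleWord s u) : AdmissibleWord (flipState s) (u.map vee) := by
  induction u generalizing s with
  | nil => trivial
  | cons i u ih =>
    refine ⟨admissible_flipState h.1, ?_⟩
    rw [vee, crossState_flipState]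
    exact ih h.2

theorem foldl_crossState_map_vee {n : ℕ} (s : WireState n) (u : List (Fin (2 * n + 1))) :
    (u.map vee).foldl crossState (flipState s) = flipState (u.foldl crossState s) := by
  induction u generalizing s with
  | nil => rfl
  | cons i u ih => rw [List.map_cons, List.foldl_cons, vee, crossState_flipState, ih]; rfl

theorem prod_adjSwap_map_vee {n : ℕ} (u : List (Fin (2 * n + 1))) :
    ((u.map vee).map adjSwap).prod = Fin.revPerm * (u.map adjSwap).prod * Fin.revPerm := by
  induction u with
  | nil => simp [revPerm_mul_self]
  | cons i u ih =>
    simp only [List.map_cons, List.prod_cons, ih, vee, adjSwap_rev, mul_assoc]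
    rw [← mul_assoc Fin.revPerm Fin.revPerm, revPerm_mul_self, one_mul]

theorem map_iterate_vee_succ {n : ℕ} (u : List (Fin (2 * n + 1))) (k : ℕ) :
    u.map (vee^[k + 1]) = (u.map (vee^[k])).map vee := by
  rw [List.map_map, Function.iterate_succ']

theorem prod_adjSwap_map_iterate_vee {n : ℕ} (u : List (Fin (2 * n + 1))) (k : ℕ) :
    ((u.map (vee^[k])).map adjSwap).prod =
      Fin.revPerm ^ k * (u.map adjSwap).prod * Fin.revPerm ^ k := by
  induction k with
  | zero => simp
  | succ k ih =>
    rw [map_iterate_vee_succ, prod_adjSwap_map_vee, ih, pow_succ' Fin.revPerm k]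
    simp only [mul_assoc]
    rw [(Commute.refl Fin.revPerm).pow_right k |>.eq]

/-- The `k`-th block is the base block conjugated by `Fin.revPerm ^ k`, so the product telescopes.
-/
theorem prod_adjSwap_blocks {n : ℕ} (u : List (Fin (2 * n + 1))) (K : ℕ) :
    (((List.range K).flatMap fun k => u.map (vee^[k])).map adjSwap).prod =
      ((u.map adjSwap).prod * Fin.revPerm) ^ K * Fin.revPerm ^ K := by
  induction K with
  | zero => simp
  | succ K ih =>
    rw [List.range_succ, List.flatMap_append, List.map_append, List.prod_append, ih,
      List.flatMap_singleton, prod_adjSwap_map_iterate_vee, pow_succ, pow_succ' Fin.revPerm]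
    have h : (Fin.revPerm ^ K * Fin.revPerm ^ K : Equiv.Perm (Fin (2 * n + 1 + 1))) = 1 := by
      rw [← (Commute.refl Fin.revPerm).mul_pow, revPerm_mul_self, one_pow]
    simp only [mul_assoc]
    rw [← mul_assoc (Fin.revPerm ^ K) (Fin.revPerm ^ K), h, one_mul,
      ← mul_assoc Fin.revPerm Fin.revPerm, revPerm_mul_self, one_mul]

/-- A block ends in the mirror image of the state in which it starts, which is just where the next,
mirrored block is admissible. -/
theorem admissibleWord_blocks {n : ℕ} {s : WireState n} {u : List (Fin (2 * n + 1))}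
    (ha : AdmissibleWord s u) (he : u.foldl crossState s = flipState s) (K : ℕ) :
    AdmissibleWord s ((List.range K).flatMap fun k => u.map (vee^[k])) ∧
      ((List.range K).flatMap fun k => u.map (vee^[k])).foldl crossState s =
        flipState^[K] s := by
  have block : ∀ k, AdmissibleWord (flipState^[k] s) (u.map (vee^[k])) ∧
      (u.map (vee^[k])).foldl crossState (flipState^[k] s) = flipState^[k + 1] s := by
    intro k
    induction k with
    | zero => simpa using ⟨ha, he⟩
    | succ k ih =>
      rw [map_iterate_vee_succ, Function.iterate_succ_apply' _ (k + 1),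
        Function.iterate_succ_apply' _ k, foldl_crossState_map_vee, ih.2,
        Function.iterate_succ_apply' _ k]
      exact ⟨admissibleWord_map_vee ih.1, rfl⟩
  induction K with
  | zero => exact ⟨trivial, rfl⟩
  | succ K ih =>
    rw [List.range_succ, List.flatMap_append, List.flatMap_singleton, admissibleWord_append,
      List.foldl_append, ih.2]
    exact ⟨⟨ih.1, (block K).1⟩, (block K).2⟩

/-- The word `1 2 ⋯ j`. -/
def ascendingWord {m : ℕ} (j : ℕ) (hj : j ≤ m) : List (Fin m) :=
  (List.finRange j).map (Fin.castLE hj)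

theorem ascendingWord_succ {m j : ℕ} (hj : j + 1 ≤ m) :
    ascendingWord (j + 1) hj = ascendingWord j (by omega) ++ [⟨j, hj⟩] := by
  simp only [ascendingWord, List.finRange_succ_last, List.map_append, List.map_map,
    List.map_cons, List.map_nil]
  rfl

theorem prod_adjSwap_ascendingWord {m j : ℕ} (hj : j ≤ m) (p : Fin (m + 1)) :
    (((ascendingWord j hj).map adjSwap).prod p).val =
      if p.val < j then p.val + 1 else if p.val = j then 0 else p.val := by
  induction j generalizing p with
  | zero =>
    simp only [ascendingWord, List.finRange_zero, List.map_nil, List.prod_nil,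
      Equiv.Perm.coe_one, id_eq]
    split_ifs <;> omega
  | succ j ih =>
    simp only [ascendingWord_succ, List.map_append, List.prod_append, List.map_cons, List.map_nil,
      List.prod_cons, List.prod_nil, mul_one, Equiv.Perm.mul_apply]
    rw [ih]
    by_cases h₁ : p = (⟨j, hj⟩ : Fin m).castSucc
    · subst h₁
      rw [adjSwap_castSucc]
      simp
    by_cases h₂ : p = (⟨j, hj⟩ : Fin m).succ
    · subst h₂
      rw [adjSwap_succ]
      simp
    rw [adjSwap_of_ne h₁ h₂]
    simp only [Fin.ext_iff, Fin.val_castSucc, Fin.val_succ] at h₁ h₂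
    split_ifs <;> omega

/-- The state after the crossings `1, 2, …, j` of the initial state of the twisted word. -/
def baseState (n j : ℕ) : WireState n := fun p =>
  if p.val ≤ n then (if p.val = j ∧ j ≠ 0 then 1 else -1) else if p.val = n + 1 then 0 else 1

theorem admissible_baseState {n j : ℕ} (hj : j ≤ n) :
    Admissible (baseState n j) ⟨j, by omega⟩ := by
  simp only [Admissible, baseState, Fin.val_succ, Fin.val_castSucc]
  refine ⟨?_, ?_, ?_⟩
  · by_cases h : j = 0 <;> simp [h, hj]
  · by_cases h : j = n
    · subst h; simp
    · right
      have : j + 1 ≤ n := by omega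
      simp [this]
  · by_cases h : j = n
    · subst h; simp
    · have : j + 1 ≤ n := by omega
      simp only [h, this, hj, if_true]
      split_ifs <;> simp

theorem crossState_baseState {n j : ℕ} (hj : j < n) :
    crossState (baseState n j) ⟨j, by omega⟩ = baseState n (j + 1) := by
  have hj' : j + 1 ≤ n := by omega
  funext p
  by_cases h₁ : p = (⟨j, by omega⟩ : Fin (2 * n + 1)).castSucc
  · subst h₁
    rw [crossState_castSucc]
    simp [baseState, hj', hj.le, arrive]
  by_cases h₂ : p = (⟨j, by omega⟩ : Fin (2 * n + 1)).succ
  · subst h₂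
    rw [crossState_succ]
    simp only [baseState, hj', hj.le, arrive, Fin.val_succ, Fin.val_castSucc, if_true]
    split_ifs <;> simp_all
  rw [crossState_of_ne _ h₁ h₂]
  simp only [Fin.ext_iff, Fin.val_castSucc, Fin.val_succ] at h₁ h₂
  simp [baseState, h₁, h₂]

theorem crossState_baseState_self (n : ℕ) :
    crossState (baseState n n) ⟨n, by omega⟩ = flipState (baseState n 0) := by
  funext p
  by_cases h₁ : p = (⟨n, by omega⟩ : Fin (2 * n + 1)).castSucc
  · subst h₁
    rw [crossState_castSucc]
    have e : 2 * n + 1 - n = n + 1 := by omega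
    simp [baseState, arrive, flipState, Fin.val_rev, e]
  by_cases h₂ : p = (⟨n, by omega⟩ : Fin (2 * n + 1)).succ
  · subst h₂
    rw [crossState_succ]
    have e : 2 * n - n = n := by omega
    simp only [baseState, arrive, flipState, Fin.val_rev, Fin.val_succ, Fin.val_castSucc]
    simp [e]
    split_ifs <;> simp_all
  rw [crossState_of_ne _ h₁ h₂]
  simp only [Fin.ext_iff, Fin.val_castSucc, Fin.val_succ] at h₁ h₂
  simp only [baseState, flipState, Fin.val_rev, h₁, h₂, false_and, if_false, ne_eq,
    not_true_eq_false, and_false]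
  have := p.isLt
  split_ifs <;> first | rfl | (exfalso; omega)

theorem admissibleWord_ascendingWord {n j : ℕ} (hj : j ≤ n) :
    AdmissibleWord (baseState n 0) (ascendingWord j (by omega)) ∧
      (ascendingWord j (by omega)).foldl crossState (baseState n 0) = baseState n j := by
  induction j with
  | zero => exact ⟨trivial, rfl⟩
  | succ j ih =>
    obtain ⟨h₁, h₂⟩ := ih (by omega)
    rw [ascendingWord_succ, admissibleWord_append, List.foldl_append, h₂]
    exact ⟨⟨h₁, admissible_baseState (by omega), trivial⟩, crossState_baseState hj⟩

theorem baseBlock_eq (n : ℕ) : baseBlock n = ascendingWord n (by omega) ++ [⟨n, by omega⟩] :=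
  ascendingWord_succ _

theorem admissibleWord_baseBlock (n : ℕ) :
    AdmissibleWord (baseState n 0) (baseBlock n) ∧
      (baseBlock n).foldl crossState (baseState n 0) = flipState (baseState n 0) := by
  obtain ⟨h₁, h₂⟩ := admissibleWord_ascendingWord (le_refl n)
  rw [baseBlock_eq, admissibleWord_append, List.foldl_append, h₂]
  exact ⟨⟨h₁, admissible_baseState le_rfl, trivial⟩, crossState_baseState_self n⟩

/-- The product of the base block with the longest element is a cycle of length `2n + 1`. -/
theorem baseBlock_mul_revPerm_pow (n : ℕ) :
    (((baseBlock n).map adjSwap).prod * Fin.revPerm) ^ (2 * n + 1) = 1 := by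
  set g : Equiv.Perm (Fin (2 * n + 1 + 1)) := ((baseBlock n).map adjSwap).prod * Fin.revPerm
    with hg
  have val : ∀ p, (g p).val = if p.val < n then 2 * n + 1 - p.val else
      if p.val = n then 0 else if p.val = n + 1 then n + 1 else 2 * n + 2 - p.val := by
    intro p
    have := p.isLt
    have h := prod_adjSwap_ascendingWord (m := 2 * n + 1) (j := n + 1) (by omega) p.rev
    change (((baseBlock n).map adjSwap).prod p.rev).val = _ at h
    rw [hg, Equiv.Perm.mul_apply, Fin.revPerm_apply, h, Fin.val_rev]
    split_ifs <;> omega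
  -- Two applications of `g` raise a position by one: `j ↦ 2n+1-j ↦ j+1` for `j < n`. Then `n ↦ 0`
  -- closes the cycle, and `n+1` is fixed.
  have even : ∀ j, j ≤ n → ((g ^ (2 * j)) 0).val = j := by
    intro j
    induction j with
    | zero => intro; simp
    | succ j ih =>
      intro hj
      rw [mul_add, mul_one, add_comm (2 * j), pow_add, pow_two, Equiv.Perm.mul_apply,
        Equiv.Perm.mul_apply, val, val, ih (by omega)]
      split_ifs <;> omega
  have period : (g ^ (2 * n + 1)) 0 = 0 := by
    ext
    rw [pow_succ', Equiv.Perm.mul_apply, val, even n le_rfl]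
    simp
  have orbit : ∀ p : Fin (2 * n + 1 + 1), p.val ≠ n + 1 → ∃ j, (g ^ j) 0 = p := by
    intro p hp
    have := p.isLt
    by_cases h : p.val ≤ n
    · exact ⟨2 * p.val, Fin.ext (even _ h)⟩
    · refine ⟨2 * (2 * n + 1 - p.val) + 1, Fin.ext ?_⟩
      rw [pow_succ', Equiv.Perm.mul_apply, val, even _ (by omega)]
      split_ifs <;> omega
  ext p
  by_cases hp : p.val = n + 1
  · have fix : g p = p := by
      ext
      rw [val, hp]
      simp
    rw [Equiv.Perm.pow_apply_eq_self_of_apply_eq_self fix]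
    rfl
  · obtain ⟨j, rfl⟩ := orbit p hp
    rw [← Equiv.Perm.mul_apply, ← pow_add, add_comm _ j, pow_add, Equiv.Perm.mul_apply, period]
    rfl

theorem isTwisted_twistedWord (n : ℕ) : IsTwisted (twistedWord n) := by
  obtain ⟨ha, he⟩ := admissibleWord_baseBlock n
  obtain ⟨h₁, h₂⟩ := admissibleWord_blocks ha he (2 * n + 1)
  refine ⟨?_, ?_, baseState n 0, h₁, h₂.trans ?_, ⟨n + 1, by omega⟩, .inr rfl, fun p => ?_⟩
  · simp only [twistedWord, List.length_flatMap, List.length_map, baseBlock, List.length_finRange,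
      List.map_const', List.length_range, List.sum_replicate, smul_eq_mul]
    ring
  -- The number of blocks is odd, so one reversal remains; likewise one flip for the state.
  · rw [twistedWord, prod_adjSwap_blocks, baseBlock_mul_revPerm_pow, one_mul, pow_succ, pow_mul,
      pow_two, revPerm_mul_self, one_pow, one_mul]
  · rw [Function.iterate_succ_apply', Function.iterate_mul]
    have : (flipState^[2] : WireState n → WireState n) = id := by
      funext s
      exact flipState_flipState s
    rw [this, Function.iterate_id]
    rfl
  · simp only [baseState, Fin.ext_iff]
    split_ifs <;> first | omega | simp_all <;> omega

/-! ### Wiring diagrams: each pair of wires crosses once. -/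

theorem adjSwap_lt_adjSwap {m : ℕ} {i : Fin m} {a b : Fin (m + 1)} (h : a < b)
    (hab : ¬(a = i.castSucc ∧ b = i.succ)) : adjSwap i a < adjSwap i b := by
  have val : ∀ p : Fin (m + 1), (adjSwap i p).val =
      if p.val = i.val then i.val + 1 else if p.val = i.val + 1 then i.val else p.val := by
    intro p
    by_cases h₁ : p = i.castSucc
    · subst h₁; simp [adjSwap_castSucc]
    by_cases h₂ : p = i.succ
    · subst h₂; simp [adjSwap_succ]
    rw [adjSwap_of_ne h₁ h₂]
    simp only [Fin.ext_iff, Fin.val_castSucc, Fin.val_succ] at h₁ h₂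
    simp [h₁, h₂]
  simp only [Fin.ext_iff, Fin.val_castSucc, Fin.val_succ] at hab
  rw [Fin.lt_def] at h ⊢
  rw [val, val]
  split_ifs <;> omega

theorem card_pairs (m : ℕ) :
    2 * (Finset.univ.filter fun q : Fin (m + 1) × Fin (m + 1) => q.1 < q.2).card =
      (m + 1) * m := by
  rw [Finset.card_filter, ← Finset.univ_product_univ, Finset.sum_product_right]
  simp only [← Finset.card_filter]
  have : ∀ y : Fin (m + 1), (Finset.univ.filter fun x => x < y).card = y.val := by
    intro y
    rw [← Fin.card_Iio y]
    congr 1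
    ext x
    simp
  simp only [this]
  rw [Fin.sum_univ_eq_sum_range (fun j => j) (m + 1), mul_comm, Finset.sum_range_id_mul_two]
  rfl

/-- The crossings `r 0, r 1, …` form an admissible wiring diagram of the longest element which
ends in the mirror image of its initial state: `perm t p` is the wire (named after its initial
position) at the position `p` after `t` crossings. -/
structure Wiring {n N : ℕ} (r : Fin N → Fin (2 * n + 1)) where
  /-- the wires -/
  perm : ℕ → Equiv.Perm (Fin (2 * n + 1 + 1))
  /-- the directions -/
  state : ℕ → WireState n
  perm_zero : perm 0 = 1
  perm_succ : ∀ v : Fin N, perm (v.val + 1) = perm v.val * adjSwap (r v)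
  perm_last : perm N = Fin.revPerm
  state_succ : ∀ v : Fin N, state (v.val + 1) = crossState (state v.val) (r v)
  state_last : state N = flipState (state 0)
  admissible : ∀ v : Fin N, Admissible (state v.val) (r v)
  middle : ∃ c : Fin (2 * n + 1 + 1), (c.val = n ∨ c.val = n + 1) ∧ ∀ p, state 0 p = 0 ↔ p = c
  length_eq : N = (n + 1) * (2 * n + 1)

theorem IsTwisted.exists_wiring {n : ℕ} {w : List (Fin (2 * n + 1))} (h : IsTwisted w) :
    ∃ W : Wiring (residue w), ∀ t, W.perm t = ((w.take t).map adjSwap).prod := by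
  obtain ⟨hl, hp, s, ha, he, hc⟩ := h
  have take_succ : ∀ v : Fin w.length, w.take (v.val + 1) = w.take v.val ++ [residue w v] :=
    fun v => List.take_succ_eq_append_getElem v.isLt
  refine ⟨⟨fun t => ((w.take t).map adjSwap).prod, fun t => (w.take t).foldl crossState s,
    by simp, fun v => ?_, by simpa using hp, fun v => ?_, by simpa using he, fun v => ?_,
    by simpa using hc, hl⟩, fun t => rfl⟩
  · rw [take_succ]
    simp
  · rw [take_succ]
    simp
  · rw [← List.take_append_drop (v.val + 1) w, take_succ, List.append_assoc,
      admissibleWord_append] at ha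
    exact ha.2.1

namespace Wiring

variable {n N : ℕ} {r : Fin N → Fin (2 * n + 1)} (W : Wiring r)

/-- The wire entering the crossing `v` from the left. -/
def leftWire (v : Fin N) : Fin (2 * n + 1 + 1) := W.perm v.val (r v).castSucc

/-- The wire entering the crossing `v` from the right. -/
def rightWire (v : Fin N) : Fin (2 * n + 1 + 1) := W.perm v.val (r v).succ

/-- The mirror image of a wiring diagram. -/
def mirror : Wiring (fun v => (r v).rev) where
  perm t := Fin.revPerm * W.perm t * Fin.revPerm
  state t := flipState (W.state t)
  perm_zero := by rw [W.perm_zero, mul_one, revPerm_mul_self]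
  perm_succ v := by
    rw [W.perm_succ, adjSwap_rev]
    simp only [mul_assoc]
    rw [← mul_assoc Fin.revPerm Fin.revPerm, revPerm_mul_self, one_mul]
  perm_last := by rw [W.perm_last, revPerm_mul_self, one_mul]
  state_succ v := by rw [W.state_succ, crossState_flipState]
  state_last := by rw [W.state_last]
  admissible v := admissible_flipState (W.admissible v)
  middle := middle_flipState W.middle
  length_eq := W.length_eq

theorem mirror_leftWire (v : Fin N) : W.mirror.leftWire v = (W.rightWire v).rev := by
  simp [leftWire, rightWire, mirror, Fin.rev_castSucc]

/-- The final permutation reverses the order of `x` and `y`, and only a crossing of these two wires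
can do so. -/
theorem exists_crossing {x y : Fin (2 * n + 1 + 1)} (h : x < y) :
    ∃ v, W.leftWire v = x ∧ W.rightWire v = y := by
  by_contra! hne
  have ordered : ∀ t, t ≤ N → (W.perm t).symm x < (W.perm t).symm y := by
    intro t
    induction t with
    | zero => intro; rw [W.perm_zero]; exact h
    | succ t ih =>
      intro ht
      rw [W.perm_succ ⟨t, ht⟩]
      refine adjSwap_lt_adjSwap (ih (by omega)) fun hab => ?_
      refine hne ⟨t, ht⟩ ?_ ?_
      · rw [leftWire, ← hab.1, Equiv.apply_symm_apply]
      · rw [rightWire, ← hab.2, Equiv.apply_symm_apply]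
  have := ordered N le_rfl
  rw [W.perm_last, Fin.revPerm_symm, Fin.revPerm_apply, Fin.revPerm_apply, Fin.rev_lt_rev] at this
  exact absurd h this.not_gt

/-- The `N` crossings cover all pairs `x < y`, and there are exactly `N` such pairs; so no crossing
is repeated or in the wrong order. -/
theorem crossing_injective_and_lt :
    Function.Injective (fun v => (W.leftWire v, W.rightWire v)) ∧
      ∀ v, W.leftWire v < W.rightWire v := by
  set F : Fin N → Fin (2 * n + 1 + 1) × Fin (2 * n + 1 + 1) :=
    fun v => (W.leftWire v, W.rightWire v) with hF
  set T := Finset.univ.filter fun q : Fin (2 * n + 1 + 1) × Fin (2 * n + 1 + 1) => q.1 < q.2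
    with hT
  have sub : T ⊆ Finset.univ.image F := by
    intro q hq
    obtain ⟨v, h₁, h₂⟩ := W.exists_crossing (Finset.mem_filter.1 hq).2
    exact Finset.mem_image.2 ⟨v, Finset.mem_univ _, Prod.ext h₁ h₂⟩
  have cardT : T.card = N := by
    have h₁ := card_pairs (2 * n + 1)
    have h₂ := W.length_eq
    rw [← hT] at h₁
    nlinarith
  have card_le : (Finset.univ.image F).card ≤ N := by
    simpa using Finset.card_image_le (s := Finset.univ) (f := F)
  have eq : T = Finset.univ.image F :=
    Finset.eq_of_subset_of_card_le sub (by omega)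
  constructor
  · have : (Finset.univ.image F).card = (Finset.univ : Finset (Fin N)).card := by
      rw [← eq, cardT, Finset.card_univ, Fintype.card_fin]
    rw [Finset.card_image_iff] at this
    exact fun a b h => this (by simp) (by simp) h
  · intro v
    have : F v ∈ T := eq ▸ Finset.mem_image_of_mem F (Finset.mem_univ v)
    exact (Finset.mem_filter.1 this).2

theorem leftWire_lt_rightWire (v : Fin N) : W.leftWire v < W.rightWire v :=
  W.crossing_injective_and_lt.2 v

theorem eq_of_wires_eq {u v : Fin N} (h₁ : W.leftWire u = W.leftWire v)
    (h₂ : W.rightWire u = W.rightWire v) : u = v :=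
  W.crossing_injective_and_lt.1 (Prod.ext h₁ h₂)

end Wiring

/-! ### Sectional paths in terms of residues. -/

/-- The arrows that lower the residue, in terms of the residue function: no position strictly
between the two ends has one of their residues. -/
def UpStep {m N : ℕ} (r : Fin N → Fin m) (k j : Fin N) : Prop :=
  (r j).val + 1 = (r k).val ∧ j < k ∧ ∀ u, j < u → u < k → r u ≠ r j ∧ r u ≠ r k

theorem arrow_iff {m : ℕ} (w : List (Fin m)) (k j : Vertex w) :
    Arrow w k j ↔ CartanMatrix.A m (residue w k) (residue w j) = -1 ∧ j < k ∧
      ∀ u, j < u → u < k → residue w u ≠ residue w j ∧ residue w u ≠ residue w k := by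
  refine and_congr_right fun _ => ⟨?_, ?_⟩
  · rintro ⟨⟨⟨hjk, -⟩, h₁⟩, ⟨-, h₂⟩⟩
    exact ⟨hjk, fun u hu hu' =>
      ⟨fun e => (h₁ ⟨hu', e⟩).not_gt hu, fun e => (h₂ ⟨hu, e⟩).not_gt hu'⟩⟩
  · rintro ⟨hjk, h⟩
    exact ⟨⟨⟨hjk, rfl⟩, fun u hu => not_lt.1 fun hlt => (h u hlt hu.1).1 hu.2⟩,
      ⟨hjk, rfl⟩, fun u hu => not_lt.1 fun hlt => (h u hu.1 hlt).2 hu.2⟩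

theorem upArrow_eq {m : ℕ} (w : List (Fin m)) : UpArrow w = UpStep (residue w) := by
  funext k j
  rw [eq_iff_iff, UpArrow, arrow_iff, cartan_eq_neg_one, UpStep, Fin.lt_def]
  constructor
  · rintro ⟨⟨h, h'⟩, hlt⟩
    exact ⟨by omega, h'⟩
  · rintro ⟨h, h'⟩
    exact ⟨⟨.inr h, h'⟩, by omega⟩

theorem downArrow_eq {m : ℕ} (w : List (Fin m)) :
    DownArrow w = UpStep fun v => (residue w v).rev := by
  funext k j
  rw [eq_iff_iff, DownArrow, arrow_iff, cartan_eq_neg_one, UpStep, Fin.lt_def]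
  simp only [Fin.val_rev, ne_eq, Fin.rev_inj]
  have := (residue w k).isLt
  have := (residue w j).isLt
  constructor
  · rintro ⟨⟨h, h'⟩, hlt⟩
    exact ⟨by omega, h'⟩
  · rintro ⟨h, h'⟩
    exact ⟨⟨.inl (by omega), h'⟩, by omega⟩

/-- The residue drops by one along every arrow of a path. -/
theorem residue_head_eq {m N : ℕ} {r : Fin N → Fin m} {h : Fin N} {t : List (Fin N)}
    (hc : (h :: t).IsChain (UpStep r)) :
    (r h).val = (r ((h :: t).getLast (by simp))).val + t.length := by
  induction t generalizing h with
  | nil => simp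
  | cons a t ih =>
    rw [List.isChain_cons_cons] at hc
    have := ih hc.2
    have := hc.1.1
    rw [List.getLast_cons (by simp), List.length_cons]
    omega

theorem nodup_of_isChain {m N : ℕ} {r : Fin N → Fin m} {p : List (Fin N)}
    (hc : p.IsChain (UpStep r)) : p.Nodup := by
  have h : p.IsChain (· > ·) := hc.imp fun _ _ h => h.2.1
  exact h.pairwise.imp fun h => h.ne'

/-- Every vertex lies on a maximal path. -/
theorem exists_maximalPath {m N : ℕ} (r : Fin N → Fin m) (v : Fin N) :
    ∃ p, IsMaximalPath (UpStep r) p ∧ v ∈ p := by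
  let S : Set (List (Fin N)) := {p | IsPath (UpStep r) p ∧ v ∈ p}
  have bound : ∀ p ∈ S, p.length ≤ N := fun p hp => by
    simpa using (nodup_of_isChain hp.1.2).length_le_card
  have hne : S.Nonempty := ⟨[v], ⟨by simp, by simp⟩, by simp⟩
  -- Lengths are bounded by `N`, so minimising `N - p.length` gives a longest path through `v`.
  obtain ⟨p, hp, hmax⟩ := (measure fun p : List (Fin N) => N - p.length).wf.has_min S hne
  refine ⟨p, ⟨hp.1, fun q hq hpq => ?_⟩, hp.2⟩
  have hqS : q ∈ S := ⟨hq, hpq.subset hp.2⟩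
  have h := hmax q hqS
  have := bound q hqS
  have := bound p hp
  change ¬(N - q.length < N - p.length) at h
  simp only [pathLength]
  omega

theorem IsMaximalPath.head_maximal {V : Type*} {R : V → V → Prop} {h : V} {t : List V}
    (hp : IsMaximalPath R (h :: t)) (v : V) : ¬R v h := by
  intro hv
  have := hp.2 (v :: h :: t) ⟨by simp, List.isChain_cons_cons.2 ⟨hv, hp.1.2⟩⟩
    (List.suffix_cons _ _).isInfix
  simp [pathLength] at this

theorem IsMaximalPath.last_maximal {V : Type*} {R : V → V → Prop} {p : List V}
    (hp : IsMaximalPath R p) (v : V) : ¬R (p.getLast hp.1.1) v := by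
  intro hv
  have := hp.2 (p ++ [v]) ⟨by simp, ?_⟩ (List.prefix_append _ _).isInfix
  · have h := List.length_pos_iff.2 hp.1.1
    simp [pathLength] at this
    omega
  · rw [List.isChain_append]
    refine ⟨hp.1.2, by simp, ?_⟩
    intro x hx y hy
    rw [List.getLast?_eq_some_getLast hp.1.1] at hx
    simp only [Option.mem_def, Option.some.injEq, List.head?_cons] at hx hy
    rwa [← hx, ← hy]

/-! ### Sectional paths follow wires. -/

namespace Wiring

variable {n N : ℕ} {r : Fin N → Fin (2 * n + 1)} (W : Wiring r)

/-- Nothing changes at a position that takes part in no crossing. -/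
theorem eq_of_no_crossing {p : Fin (2 * n + 1 + 1)} {t₁ t₂ : ℕ} (h₁₂ : t₁ ≤ t₂) (h₂ : t₂ ≤ N)
    (h : ∀ v : Fin N, t₁ ≤ v.val → v.val < t₂ → p ≠ (r v).castSucc ∧ p ≠ (r v).succ) :
    W.perm t₂ p = W.perm t₁ p ∧ W.state t₂ p = W.state t₁ p := by
  induction t₂, h₁₂ using Nat.le_induction with
  | base => exact ⟨rfl, rfl⟩
  | succ t ht ih =>
    obtain ⟨e₁, e₂⟩ := ih (by omega) fun v hv hv' => h v hv (by omega)
    obtain ⟨n₁, n₂⟩ := h ⟨t, h₂⟩ ht (by simp)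
    have hp := W.perm_succ ⟨t, h₂⟩
    have hs := W.state_succ ⟨t, h₂⟩
    simp only at hp hs
    rw [hp, hs, Equiv.Perm.mul_apply, adjSwap_of_ne n₁ n₂, crossState_of_ne _ n₁ n₂]
    exact ⟨e₁, e₂⟩

theorem state_eq_zero {t : ℕ} (ht : t ≤ N) (p : Fin (2 * n + 1 + 1)) :
    W.state t p = 0 ↔ W.state 0 (W.perm t p) = 0 := by
  induction t generalizing p with
  | zero => simp [W.perm_zero]
  | succ t ih =>
    have hp := W.perm_succ ⟨t, ht⟩
    have hs := W.state_succ ⟨t, ht⟩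
    simp only at hp hs
    rw [hp, hs, crossState_eq_zero, ih (by omega), Equiv.Perm.mul_apply]

/-- The central wire does not enter the crossing `v` from the left. -/
theorem state_castSucc_eq_zero (v : Fin N) :
    W.state v.val (r v).castSucc = 0 ↔ W.state 0 (W.leftWire v) = 0 :=
  W.state_eq_zero v.isLt.le _

theorem state_succ_eq_zero (v : Fin N) :
    W.state v.val (r v).succ = 0 ↔ W.state 0 (W.rightWire v) = 0 :=
  W.state_eq_zero v.isLt.le _

theorem perm_succ_succ (v : Fin N) : W.perm (v.val + 1) (r v).succ = W.leftWire v := by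
  rw [W.perm_succ, Equiv.Perm.mul_apply, adjSwap_succ, leftWire]

/-- The left wire of `j` leaves `j` at the position `r j + 1`; nothing touches that position until
`k`, which it enters from the left. -/
theorem leftWire_eq_of_upStep {k j : Fin N} (h : UpStep r k j) :
    W.leftWire k = W.leftWire j := by
  obtain ⟨hr, hjk, hu⟩ := h
  have e : (r k).castSucc = (r j).succ := by ext; simp [hr]
  rw [leftWire, e, ← W.perm_succ_succ]
  refine (W.eq_of_no_crossing hjk k.isLt.le fun u h₁ h₂ => ?_).1
  obtain ⟨n₁, n₂⟩ := hu u h₁ h₂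
  rw [← e]
  refine ⟨fun h => n₂ (Fin.castSucc_injective _ h).symm, fun h => n₁ ?_⟩
  rw [e] at h
  exact (Fin.succ_injective _ h).symm

/-- The wire leaves `v` moving right. If another crossing followed at its position, entering it from
the left would give an arrow, and entering it from the right would be a forbidden reversal. -/
theorem final_of_no_upStep {v : Fin N} (hv : W.state 0 (W.leftWire v) ≠ 0)
    (hl : (r v).val ≠ 2 * n) (h : ∀ u, ¬UpStep r u v) :
    W.perm N (r v).succ = W.leftWire v ∧ W.state N (r v).succ = 1 := by
  have hs : W.state (v.val + 1) (r v).succ = 1 := by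
    rw [W.state_succ, crossState_succ, arrive, if_neg]
    rwa [W.state_castSucc_eq_zero]
  rw [← W.perm_succ_succ, ← hs]
  refine W.eq_of_no_crossing v.isLt le_rfl ?_
  by_contra hex
  let S : Set (Fin N) := {u | v < u ∧ ((r v).succ = (r u).castSucc ∨ (r v).succ = (r u).succ)}
  have hne : S.Nonempty := by
    push Not at hex
    obtain ⟨u, h₁, -, h₂⟩ := hex
    exact ⟨u, h₁, or_iff_not_imp_left.2 h₂⟩
  obtain ⟨u, ⟨hvu, hu⟩, hmin⟩ := (wellFounded_lt (α := Fin N)).has_min S hne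
  have between : ∀ x, v < x → x < u → (r v).succ ≠ (r x).castSucc ∧ (r v).succ ≠ (r x).succ := by
    intro x h₁ h₂
    exact not_or.1 fun hx => hmin x ⟨h₁, hx⟩ h₂
  have key := (W.eq_of_no_crossing hvu u.isLt.le between).2
  rw [hs] at key
  rcases hu with hu | hu
  · refine h u ⟨by simpa [Fin.ext_iff] using hu, hvu, fun x h₁ h₂ => ?_⟩
    obtain ⟨n₁, n₂⟩ := between x h₁ h₂
    exact ⟨fun e => n₂ (by rw [e]), fun e => n₁ (by rw [e, hu])⟩
  · have hru : r v = r u := Fin.succ_injective _ hu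
    rw [hru] at key hl
    exact (W.admissible u).2.1.elim hl fun h => h key

/-- The wire enters `v` with mark `1`. A previous crossing at its position either left a mark other
than `1` or gives an arrow out of `v`. -/
theorem initial_of_no_upStep {v : Fin N} (hv : W.state 0 (W.leftWire v) ≠ 0)
    (hl : (r v).val ≠ 0) (h : ∀ u, ¬UpStep r v u) :
    W.leftWire v = (r v).castSucc ∧ W.state 0 (r v).castSucc = 1 := by
  have hs : W.state v.val (r v).castSucc = 1 := by
    have h₀ : W.state v.val (r v).castSucc ≠ 0 := by rwa [ne_eq, W.state_castSucc_eq_zero]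
    have h₁ := (W.admissible v).1.resolve_left hl
    revert h₀ h₁
    generalize W.state v.val (r v).castSucc = k
    revert k
    decide
  suffices hno : ∀ u : Fin N, 0 ≤ u.val → u.val < v.val →
      (r v).castSucc ≠ (r u).castSucc ∧ (r v).castSucc ≠ (r u).succ by
    obtain ⟨e₁, e₂⟩ := W.eq_of_no_crossing (Nat.zero_le _) v.isLt.le hno
    rw [← e₂, leftWire, e₁, W.perm_zero]
    exact ⟨rfl, hs⟩
  by_contra hex
  let S : Set (Fin N) := {u | u < v ∧ ((r v).castSucc = (r u).castSucc ∨
    (r v).castSucc = (r u).succ)}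
  have hne : S.Nonempty := by
    push Not at hex
    obtain ⟨u, -, h₁, h₂⟩ := hex
    exact ⟨u, h₁, or_iff_not_imp_left.2 h₂⟩
  obtain ⟨u, ⟨huv, hu⟩, hmax⟩ := (wellFounded_gt (α := Fin N)).has_min S hne
  have between : ∀ x, u < x → x < v →
      (r v).castSucc ≠ (r x).castSucc ∧ (r v).castSucc ≠ (r x).succ := by
    intro x h₁ h₂
    exact not_or.1 fun hx => hmax x ⟨h₂, hx⟩ h₁
  have key := (W.eq_of_no_crossing huv v.isLt.le between).2
  rcases hu with hu | hu
  · rw [hs, hu, W.state_succ, crossState_castSucc, arrive] at key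
    split_ifs at key
  · refine h u ⟨by simpa [Fin.ext_iff] using hu.symm, huv, fun x h₁ h₂ => ?_⟩
    obtain ⟨n₁, n₂⟩ := between x h₁ h₂
    exact ⟨fun e => n₂ (by rw [e, hu]), fun e => n₁ (by rw [e])⟩

theorem leftWire_eq_of_mem {h : Fin N} {t : List (Fin N)}
    (hc : (h :: t).IsChain (UpStep r)) : ∀ v ∈ h :: t, W.leftWire v = W.leftWire h := by
  induction t generalizing h with
  | nil => simp
  | cons a t ih =>
    rw [List.isChain_cons_cons] at hc
    intro v hv
    rcases List.mem_cons.1 hv with rfl | hv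
    · rfl
    · rw [ih hc.2 v hv, W.leftWire_eq_of_upStep hc.1]

/-- Crossings with a common left wire have distinct right wires, all greater than it; count them. -/
theorem leftWire_add_length_le {h : Fin N} {t : List (Fin N)}
    (hc : (h :: t).IsChain (UpStep r)) : (W.leftWire h).val + t.length ≤ 2 * n := by
  have hL := W.leftWire_eq_of_mem hc
  have nodup : ((h :: t).map W.rightWire).Nodup := by
    refine List.Nodup.map_on (fun a ha b hb e => W.eq_of_wires_eq ?_ e) (nodup_of_isChain hc)
    rw [hL a ha, hL b hb]
  have sub : ((h :: t).map W.rightWire).toFinset ⊆ Finset.Ioi (W.leftWire h) := by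
    intro y hy
    obtain ⟨v, hv, rfl⟩ := List.mem_map.1 (List.mem_toFinset.1 hy)
    rw [Finset.mem_Ioi, ← hL v hv]
    exact W.leftWire_lt_rightWire v
  have := Finset.card_le_card sub
  rw [List.toFinset_card_of_nodup nodup, Fin.card_Ioi, List.length_map, List.length_cons] at this
  omega

/-- The length of a maximal path of arrows lowering the residue, along a wire other than the
central one. -/
theorem leftWire_add_pathLength {p : List (Fin N)} (hp : IsMaximalPath (UpStep r) p)
    {v : Fin N} (hv : v ∈ p) (h₀ : W.state 0 (W.leftWire v) ≠ 0) :
    (W.leftWire v).val + pathLength p = 2 * n := by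
  obtain ⟨h, t, rfl⟩ := List.exists_cons_of_ne_nil hp.1.1
  have hL := W.leftWire_eq_of_mem hp.1.2
  have hres := residue_head_eq hp.1.2
  have hle := W.leftWire_add_length_le hp.1.2
  have hlast := hp.last_maximal
  have hhead := hp.head_maximal
  have hll := hL _ (List.getLast_mem hp.1.1)
  generalize (h :: t).getLast _ = l at hres hlast hll
  rw [hL v hv] at h₀ ⊢
  have e : pathLength (h :: t) = t.length := by simp [pathLength]
  rw [e]
  have final := W.final_of_no_upStep h₀
  have initial := W.initial_of_no_upStep (v := l) (by rwa [hll])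
  rw [hll] at initial
  rw [W.perm_last, Fin.revPerm_apply] at final
  have hlt := (r h).isLt
  by_cases hf : (r h).val = 2 * n
  · by_cases hi : (r l).val = 0
    · omega
    · have := congrArg Fin.val (initial hi hlast).1
      rw [Fin.val_castSucc] at this
      omega
  · obtain ⟨f₁, f₂⟩ := final hf hhead
    have hv := congrArg Fin.val f₁
    rw [Fin.val_rev, Fin.val_succ] at hv
    by_cases hi : (r l).val = 0
    · omega
    · obtain ⟨i₁, i₂⟩ := initial hi hlast
      -- The wire would both start and end moving right, against the mirror condition.
      rw [W.state_last, flipState, f₁, i₁, i₂] at f₂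
      exact absurd f₂ (by decide)

end Wiring

/-! ### The middle residue and the segments. -/

namespace Wiring

variable {n N : ℕ} {r : Fin N → Fin (2 * n + 1)} (W : Wiring r)

theorem state_leftWire_ne_zero {v : Fin N} (hv : (r v).val ≠ n) :
    W.state 0 (W.leftWire v) ≠ 0 := by
  rw [ne_eq, ← W.state_castSucc_eq_zero]
  exact fun h => hv ((W.admissible v).2.2.2 (.inl h))

theorem state_rightWire_eq_zero {v : Fin N} (hv : (r v).val = n)
    (h : W.state 0 (W.leftWire v) ≠ 0) : W.state 0 (W.rightWire v) = 0 := by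
  rw [← W.state_succ_eq_zero]
  rw [ne_eq, ← W.state_castSucc_eq_zero] at h
  exact ((W.admissible v).2.2.1 hv).resolve_left h

/-- A wire other than the central one meets the middle residue only once. -/
theorem eq_of_leftWire_eq {u v : Fin N} (hu : (r u).val = n) (hv : (r v).val = n)
    (h : W.state 0 (W.leftWire v) ≠ 0) (huv : W.leftWire u = W.leftWire v) : u = v := by
  obtain ⟨c, -, hc⟩ := W.middle
  refine W.eq_of_wires_eq huv ?_
  rw [(hc _).1 (W.state_rightWire_eq_zero hv h),
    (hc _).1 (W.state_rightWire_eq_zero hu (by rwa [huv]))]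

/-- A maximal path along a wire other than the central one is induced. -/
theorem exists_residue_ne (hn : n ≠ 0) {p : List (Fin N)} (hp : IsMaximalPath (UpStep r) p)
    {v : Fin N} (hv : v ∈ p) (h : W.state 0 (W.leftWire v) ≠ 0) :
    ∃ u ∈ p, (r u).val ≠ n := by
  -- A path inside the middle residue is a single vertex, so its wire would be `2n`; it must lie to
  -- the left of the central wire, which is at most `n + 1`.
  by_contra! hall
  have hlen := W.leftWire_add_pathLength hp hv h
  obtain ⟨a, t, rfl⟩ := List.exists_cons_of_ne_nil hp.1.1
  have hres := residue_head_eq hp.1.2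
  rw [hall a (by simp), hall _ (List.getLast_mem hp.1.1)] at hres
  have e : pathLength (a :: t) = t.length := by simp [pathLength]
  obtain ⟨c, hc, h₀⟩ := W.middle
  have hR := (h₀ _).1 (W.state_rightWire_eq_zero (hall v hv) h)
  have hlt := W.leftWire_lt_rightWire v
  rw [hR, Fin.lt_def] at hlt
  omega

/-- The segment of the root `e_x - e_y` labelling the crossing of the wires `x < y`. -/
def segment (v : Fin N) : Segment (2 * n + 1) where
  first := (W.leftWire v).val + 1
  second := (W.rightWire v).val
  one_le_first := by omega
  first_le_second := W.leftWire_lt_rightWire v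
  second_le := by omega

theorem segment_root (v : Fin N) :
    (W.segment v).root = diffRoot (W.leftWire v) (W.rightWire v) := by
  have h := W.leftWire_lt_rightWire v
  rw [Fin.lt_def] at h
  funext k
  simp only [Segment.root, segment, diffRoot]
  split_ifs <;> omega

theorem segment_bijective : Function.Bijective W.segment := by
  constructor
  · intro u v h
    have h₁ := congrArg Segment.first h
    have h₂ := congrArg Segment.second h
    simp only [segment] at h₁ h₂
    exact W.eq_of_wires_eq (Fin.ext (by omega)) (Fin.ext h₂)
  · rintro ⟨a, b, ha, hab, hb⟩
    obtain ⟨v, h₁, h₂⟩ := W.exists_crossing (x := ⟨a - 1, by omega⟩) (y := ⟨b, by omega⟩)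
      (by rw [Fin.lt_def]; simp only; omega)
    refine ⟨v, Segment.ext ?_ ?_⟩
    · simp only [segment, h₁]
      omega
    · simp only [segment, h₂]

end Wiring

/-! ### The two rules and uniqueness. -/

variable {n : ℕ} {w : List (Fin (2 * n + 1))}

theorem nRule_segment (W : Wiring (residue w)) : NRule w W.segment := by
  rintro p k hp ⟨u, hu, hun⟩ hk v hv
  rw [IsMaximalNSectional, upArrow_eq] at hp
  obtain ⟨a, t, rfl⟩ := List.exists_cons_of_ne_nil hp.1.1
  have h₀ := W.state_leftWire_ne_zero (v := u) (by omega)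
  have hL : W.leftWire v = W.leftWire u :=
    (W.leftWire_eq_of_mem hp.1.2 v hv).trans (W.leftWire_eq_of_mem hp.1.2 u hu).symm
  have := W.leftWire_add_pathLength hp hv (by rwa [hL])
  simp only [Wiring.segment]
  omega

theorem sRule_segment (W : Wiring (residue w)) : SRule w W.segment := by
  rintro p k hp ⟨u, hu, hun⟩ hk v hv
  rw [IsMaximalSSectional, downArrow_eq] at hp
  obtain ⟨a, t, rfl⟩ := List.exists_cons_of_ne_nil hp.1.1
  have h₀ := W.mirror.state_leftWire_ne_zero (v := u) (by rw [Fin.val_rev]; omega)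
  have hL : W.mirror.leftWire v = W.mirror.leftWire u :=
    (W.mirror.leftWire_eq_of_mem hp.1.2 v hv).trans
      (W.mirror.leftWire_eq_of_mem hp.1.2 u hu).symm
  have := W.mirror.leftWire_add_pathLength hp hv (by rwa [hL])
  rw [W.mirror_leftWire, Fin.val_rev] at this
  simp only [Wiring.segment]
  omega

/-- Two labellings subject to the first rule agree in the first component on every induced
maximal path. -/
theorem NRule.first_eq {f g : Vertex w → Segment (2 * n + 1)} (hf : NRule w f) (hg : NRule w g)
    {p : List (Vertex w)} (hp : IsMaximalPath (UpStep (residue w)) p)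
    (hi : ∃ u ∈ p, (residue w u).val ≠ n) {v : Vertex w} (hv : v ∈ p) :
    (g v).first = (f v).first := by
  rw [← upArrow_eq] at hp
  obtain ⟨u, hu, hun⟩ := hi
  have hi : IsInduced w p := ⟨u, hu, by omega⟩
  have h₁ := hf p _ hp hi rfl v hv
  have h₂ := hg p _ hp hi rfl v hv
  omega

theorem SRule.second_eq {f g : Vertex w → Segment (2 * n + 1)} (hf : SRule w f) (hg : SRule w g)
    {p : List (Vertex w)} (hp : IsMaximalPath (UpStep fun v => (residue w v).rev) p)
    (hi : ∃ u ∈ p, (residue w u).rev.val ≠ n) {v : Vertex w} (hv : v ∈ p) :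
    (g v).second = (f v).second := by
  rw [← downArrow_eq] at hp
  obtain ⟨u, hu, hun⟩ := hi
  rw [Fin.val_rev] at hun
  have hi : IsInduced w p := ⟨u, hu, by omega⟩
  rw [hf p _ hp hi rfl v hv, hg p _ hp hi rfl v hv]

/-- The labelling by roots is the only bijection subject to both rules. -/
theorem eq_segment (W : Wiring (residue w)) {g : Vertex w → Segment (2 * n + 1)}
    (hg : Function.Injective g) (hN : NRule w g) (hS : SRule w g) : g = W.segment := by
  have outer : ∀ v, (residue w v).val ≠ n → g v = W.segment v := by
    intro v hv
    obtain ⟨p, hp, hvp⟩ := exists_maximalPath (residue w) v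
    obtain ⟨q, hq, hvq⟩ := exists_maximalPath (fun v => (residue w v).rev) v
    exact Segment.ext ((nRule_segment W).first_eq hN hp ⟨v, hvp, hv⟩ hvp)
      ((sRule_segment W).second_eq hS hq ⟨v, hvq, by rw [Fin.val_rev]; omega⟩ hvq)
  funext v
  by_cases hv : (residue w v).val = n
  swap
  · exact outer v hv
  -- For `n = 0` no path is induced, but there is only the segment `[1, 1]`.
  rcases eq_or_ne n 0 with rfl | hn
  · have h₁ := (g v).one_le_first
    have h₂ := (g v).first_le_second
    have h₃ := (g v).second_le
    have h₄ := (W.segment v).one_le_first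
    have h₅ := (W.segment v).first_le_second
    have h₆ := (W.segment v).second_le
    exact Segment.ext (by omega) (by omega)
  obtain ⟨u, hu⟩ := W.segment_bijective.2 (g v)
  suffices u = v by rw [← hu, this]
  by_cases hun : (residue w u).val = n
  swap
  · exact hg ((outer u hun).trans hu)
  -- Now `u` and `v` are both middle crossings. The component of the noncentral wire of `v` is
  -- forced, so `u` shares that wire; if the left wire is central, this is applied to the mirror
  -- image.
  by_cases h₀ : W.state 0 (W.leftWire v) = 0
  · have hv' : (residue w v).rev.val = n := by rw [Fin.val_rev]; omega
    have h₁ : W.mirror.state 0 (W.mirror.leftWire v) ≠ 0 := by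
      obtain ⟨c, -, hc⟩ := W.middle
      rw [W.mirror_leftWire]
      simp only [Wiring.mirror, flipState, Fin.rev_rev, ne_eq, SignType.neg_eq_zero_iff]
      intro h
      have := W.leftWire_lt_rightWire v
      rw [(hc _).1 h, (hc _).1 h₀] at this
      exact lt_irrefl _ this
    refine W.mirror.eq_of_leftWire_eq (by rw [Fin.val_rev]; omega) hv' h₁ ?_
    obtain ⟨p, hp, hvp⟩ := exists_maximalPath (fun v => (residue w v).rev) v
    have := (sRule_segment W).second_eq hS hp (W.mirror.exists_residue_ne hn hp hvp h₁) hvp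
    rw [← hu] at this
    rw [W.mirror_leftWire, W.mirror_leftWire, Fin.rev_inj]
    exact Fin.ext this
  · refine W.eq_of_leftWire_eq hun hv h₀ (Fin.ext ?_)
    obtain ⟨p, hp, hvp⟩ := exists_maximalPath (residue w) v
    have := (nRule_segment W).first_eq hN hp (W.exists_residue_ne hn hp hvp h₀) hvp
    rw [← hu] at this
    simpa [Wiring.segment] using this

end TwistedAR

/-- Let `w` be any word in a twisted adapted class of type `A_{2n+1}`. The root labels of its
combinatorial AR-quiver are segments, given by a bijection `f` from vertices to segments, for
which (1) induced maximal `N`-sectional paths of length `k` share the first component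
`2n + 1 - k`, (2) induced maximal `S`-sectional paths of length `k` share the second component
`k + 1`; and these two rules alone determine the labelling of all vertices among the bijections
from vertices to segments. -/
theorem mainTheorem5 (n : ℕ) (w : List (Fin (2 * n + 1)))
    (hw : TwistedAR.commClass w ∈ TwistedAR.twistedAdaptedClusterPoint n) :
    ∃ f : TwistedAR.Vertex w → TwistedAR.Segment (2 * n + 1),
      (∀ v, TwistedAR.rootLabel w v = (f v).root) ∧
      Function.Bijective f ∧
      TwistedAR.NRule w f ∧
      TwistedAR.SRule w f ∧
      ∀ g : TwistedAR.Vertex w → TwistedAR.Segment (2 * n + 1),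
        Function.Bijective g → TwistedAR.NRule w g → TwistedAR.SRule w g → g = f := by
  obtain ⟨W, hW⟩ :=
    (TwistedAR.isTwisted_of_mem (TwistedAR.isTwisted_twistedWord n) hw).exists_wiring
  refine ⟨W.segment, fun v => ?_, W.segment_bijective, TwistedAR.nRule_segment W,
    TwistedAR.sRule_segment W, fun g hg hN hS => TwistedAR.eq_segment W hg.1 hN hS⟩
  rw [W.segment_root, TwistedAR.rootLabel_eq_diffRoot, ← hW]
  rfl
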